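/- **Setting.** There are $K$ arms $\mathcal K=\{0,\dots,K-1\}$; the rewards of arm $a$ have law $\nu_a$ with mean $\mu_a$, and $X-\mu_a$ is $1$-subGaussian for $X\sim\nu_a$, i.e. $\mathbb E\,e^{s(X-\mu_a)}\le e^{s^2/2}$ for all $s\in\mathbb R$. The best arm $a^\star$ is unique, and $\Delta_a=\mu_{a^\star}-\mu_a>0$ for $a\ne a^\star$. In each round a learner sends one symbol of $\mathcal K$ over a discrete memoryless channel $W$ from $\mathcal K$ to $\mathcal K$, and an agent, who sees the channel outputs, pulls one arm. The learner sees the reward but neither the channel output nor the arm that is pulled. Rewards and channel noise are independent across rounds and of each other. $G$ is the confusability graph of $W$ (distinct inputs $x,x'$ are adjacent iff some output has positive probability under both), $G^{\boxtimes n}$ its $n$-fold strong power, and $\alpha$ the independence number. Let $\delta\in(0,1)$. **Clean phased successive elimination (SE).** Put $S_1=\mathcal K$, $m_r=2^{r-1}$, $t_r=2^r-1$ and $\beta(t)=\sqrt{2\log(8Kt^2/\delta)/t}$. In phase $r=1,2,\dots$, as long as $|S_r|>1$, each arm of $S_r$ is pulled $m_r$ times (in increasing order of the arms), directly and without a channel;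 with $\hat\mu_a(t_r)$ the mean of the $t_r$ rewards of arm $a$ so far, $$S_{r+1}=\Big\{a\in S_r:\ \hat\mu_a(t_r)+\beta(t_r)\ \ge\ \max_{b\in S_r}\big(\hat\mu_b(t_r)-\beta(t_r)\big)\Big\}.$$ When one arm is left, the algorithm stops and returns it. Its pull complexity $N_{\rm SE}(\delta,\mu)$ is the least $N\in\mathbb N\cup\{\infty\}$ such that, for all reward laws with mean vector $\mu$ that are $1$-subGaussian in the above sense, it stops within $N$ pulls with probability at least $1-\delta$. **Packetized successive elimination (PSE).** Let $\mathcal P_r$ be families of subsets of $\mathcal K$ (the admissible active sets of phase $r$) and $n_r\ge 0$ integers. A zero-error plan packet of length $n_r$ is an encoder of active sets into $\mathcal K^{n_r}$ with a decoder that recovers each member of $\mathcal P_r$ from every channel output sequence that has positive probability. PSE follows SE, but phase $r$ starts with $n_r$ rounds in which the learner sends the packet for the plan "pull each arm of $S_r$ exactly $m_r$ times", while the agent keeps pulling the arm that it pulled last (an arbitrary fixed arm before phase 1) and these rewards are not counted; then, for $|S_r|m_r$ rounds, the agent executes the plan that it has decoded, and these rewards are counted. Let $R$ be the number of executed phases and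 $\tau$ the total number of physical rounds. **Theorem.** Assume $\alpha(G^{\boxtimes n_r})\ge|\mathcal P_r|$ for all $r\ge 1$. Then zero-error plan packets of the lengths $n_r$ exist. For every choice of such packets for which, almost surely, $S_r\in\mathcal P_r$ in every executed phase $r$ (for instance, if $\mathcal P_r$ consists of all nonempty subsets of $\mathcal K$): 1. PSE is $\delta$-correct: with probability at least $1-\delta$ it stops and returns $a^\star$. 2. With probability at least $1-\delta$, PSE stops and $$\tau\ \le\ N_{\rm SE}(\delta,\mu)+\sum_{r=1}^{R}n_r .$$ Moreover, there is a universal constant $C>0$ such that, for all $K$, $\delta$ and $\mu$ as above, with $\ell_a=1+\max\{0,\log(1/\Delta_a)\}$, $$N_{\rm SE}(\delta,\mu)\ \le\ C\sum_{a\neq a^\star}\left(1+\frac{\ell_a}{\Delta_a^{2}}\,\log\frac{K\,\ell_a}{\delta}\right),$$ that is, $N_{\rm SE}(\delta,\mu)=\tilde O\big(\sum_{a\ne a^\star}\Delta_a^{-2}\log\frac{K\log(1/\Delta_a)}{\delta}\big)$ for gaps bounded by a constant. -/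

import Mathlib

open MeasureTheory ProbabilityTheory
open scoped ENNReal

noncomputable section

namespace PSE

/-! ### Zero-error communication over the actuation channel

The channel is a stochastic matrix `W : Fin K → PMF (Fin K)`, where `W x y` is the probability of
the output `y` on the input `x`. -/

/-- The confusability graph: two distinct inputs are adjacent iff they have a common possible
output. -/
def confusabilityGraph {K : ℕ} (W : Fin K → PMF (Fin K)) : SimpleGraph (Fin K) where
  Adj x x' := x ≠ x' ∧ ((W x).support ∩ (W x').support).Nonempty
  symm := ⟨fun _ _ h => ⟨h.1.symm, by rw [Set.inter_comm]; exact h.2⟩⟩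
  loopless := ⟨fun _ h => h.1 rfl⟩

/-- The `n`-fold strong power of a graph: two distinct sequences are adjacent iff in every
coordinate they are equal or adjacent. -/
def strongPower {V : Type*} (G : SimpleGraph V) (n : ℕ) : SimpleGraph (Fin n → V) where
  Adj x x' := x ≠ x' ∧ ∀ i, x i = x' i ∨ G.Adj (x i) (x' i)
  symm := ⟨fun _ _ h => ⟨h.1.symm, fun i => (h.2 i).imp Eq.symm (fun e => e.symm)⟩⟩
  loopless := ⟨fun _ h => h.1 rfl⟩

/-- A zero-error plan packet of length `n` for the plan family `P`. The repetition budget of a phase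
is agreed upon in advance, so a plan is identified with its active set. Whatever the channel can
output on the codeword of a plan of `P`, the decoder returns that plan. -/
structure ZeroErrorPacket {K : ℕ} (W : Fin K → PMF (Fin K)) (P : Finset (Finset (Fin K)))
    (n : ℕ) where
  /-- the codeword of a plan -/
  enc : Finset (Fin K) → Fin n → Fin K
  /-- the decoder of the agent -/
  dec : (Fin n → Fin K) → Finset (Fin K)
  zero_error : ∀ S ∈ P, ∀ y : Fin n → Fin K, (∀ i, y i ∈ (W (enc S i)).support) → dec y = S

/-! ### Phased successive elimination

Phases are numbered `r = 0, 1, 2, …`; the phase `r` here is the `(r + 1)`-st phase. -/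

/-- The number of counted pulls per active arm in the `(r + 1)`-st phase. -/
def budget (r : ℕ) : ℕ := 2 ^ r

/-- The number of counted pulls of an active arm in the first `r + 1` phases. -/
def countedPulls (r : ℕ) : ℕ := 2 ^ (r + 1) - 1

/-- The confidence radius `β(t) = √(2 log (8 K t² / δ) / t)`. -/
def radius (K : ℕ) (δ : ℝ) (t : ℕ) : ℝ :=
  Real.sqrt (2 * Real.log (8 * K * (t : ℝ) ^ 2 / δ) / t)

/-- The state between two phases. -/
structure RunState (K : ℕ) where
  /-- the active set -/
  active : Finset (Fin K)
  /-- for each arm, the sum of the rewards that the learner has counted for it -/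
  total : Fin K → ℝ
  /-- the arms that were physically pulled so far, one for each round, in order -/
  pulled : List (Fin K)

/-- Before the first phase all arms are active. -/
def RunState.init (K : ℕ) : RunState K := ⟨Finset.univ, 0, []⟩

/-- The arm that is pulled in slot `k = 0, 1, …, |S| m - 1` of the plan "pull each arm of `S`
exactly `m` times", which goes through `S` in increasing order; `none` for later slots. -/
def planSlot {K : ℕ} (S : Finset (Fin K)) (m k : ℕ) : Option (Fin K) :=
  S.sort[k / m]?

/-- The elimination rule at the end of phase `r`: an arm of `S` stays active iff its upper
confidence bound is at least the largest lower confidence bound over `S`. -/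
def nextActive {K : ℕ} (δ : ℝ) (r : ℕ) (S : Finset (Fin K)) (total : Fin K → ℝ) :
    Finset (Fin K) :=
  S.filter fun a => ∀ b ∈ S,
    total b / countedPulls r - radius K δ (countedPulls r) ≤
      total a / countedPulls r + radius K δ (countedPulls r)

/-- The sums of counted rewards after a phase in which the learner receives the reward `y k` in slot
`k` of the plan for `S` and counts it for the arm that the plan has in that slot. -/
def addRewards {K : ℕ} (S : Finset (Fin K)) (m : ℕ) (y : ℕ → ℝ) (total : Fin K → ℝ) :
    Fin K → ℝ :=
  fun a => total a + ∑ k ∈ Finset.range (S.card * m), if planSlot S m k = some a then y k else 0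

/-- One phase of the clean algorithm: no channel and no installation. `x t a` is the reward of
arm `a` in round `t`. -/
def cleanPhase {K : ℕ} (δ : ℝ) (x : ℕ → Fin K → ℝ) (r : ℕ) (st : RunState K) : RunState K :=
  let S := st.active
  let m := budget r
  let start := st.pulled.length
  let pulls := (List.range (S.card * m)).filterMap (planSlot S m)
  let reward : ℕ → ℝ := fun k => ((planSlot S m k).map (x (start + k))).getD 0
  let total := addRewards S m reward st.total
  ⟨nextActive δ r S total, total, st.pulled ++ pulls⟩

/-- The states of the clean phased successive elimination algorithm; the state does not change any
more once the algorithm has stopped. -/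
def cleanRun {K : ℕ} (δ : ℝ) (x : ℕ → Fin K → ℝ) : ℕ → RunState K
  | 0 => RunState.init K
  | r + 1 =>
    if 1 < (cleanRun δ x r).active.card then cleanPhase δ x r (cleanRun δ x r)
    else cleanRun δ x r

/-- One phase of packetized successive elimination. In round `t`, `(ω t).1 v` is the channel output
that results if the learner sends `v`, and `(ω t).2 a` is the reward that results if the agent pulls
arm `a`.

Install: in the next `n` rounds the learner sends the codeword of the plan for the active set `S`,
while the agent keeps pulling the last arm that it has pulled (at the very beginning: `h₀`); the
rewards of these rounds are not counted.
Execute: in the following `|S| m` rounds the agent executes the plan `S'` that it has decoded from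
the channel outputs (it would continue with the hold arm after the end of that plan), and the
learner, who does not see which arms are pulled, counts the rewards as for the plan for `S`. What is
sent over the channel in these rounds plays no role. -/
def packetPhase {K : ℕ} {W : Fin K → PMF (Fin K)} (δ : ℝ) {P : Finset (Finset (Fin K))} {n : ℕ}
    (code : ZeroErrorPacket W P n) (h₀ : Fin K)
    (ω : ℕ → (Fin K → Fin K) × (Fin K → ℝ)) (r : ℕ) (st : RunState K) : RunState K :=
  let S := st.active
  let m := budget r
  let start := st.pulled.length
  let hold := st.pulled.getLastD h₀
  let S' := code.dec fun i => (ω (start + i)).1 (code.enc S i)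
  let executed : ℕ → Fin K := fun k => (planSlot S' m k).getD hold
  let reward : ℕ → ℝ := fun k => (ω (start + n + k)).2 (executed k)
  let total := addRewards S m reward st.total
  ⟨nextActive δ r S total, total,
    st.pulled ++ List.replicate n hold ++ (List.range (S.card * m)).map executed⟩

/-- The states of packetized successive elimination; the state does not change any more once the
algorithm has stopped. -/
def packetRun {K : ℕ} {W : Fin K → PMF (Fin K)} (δ : ℝ) {P : ℕ → Finset (Finset (Fin K))}
    {n : ℕ → ℕ} (code : ∀ r, ZeroErrorPacket W (P r) (n r)) (h₀ : Fin K)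
    (ω : ℕ → (Fin K → Fin K) × (Fin K → ℝ)) : ℕ → RunState K
  | 0 => RunState.init K
  | r + 1 =>
    if 1 < (packetRun δ code h₀ ω r).active.card then
      packetPhase δ (code r) h₀ ω r (packetRun δ code h₀ ω r)
    else packetRun δ code h₀ ω r

/-- A run stops after exactly `R` phases. -/
def StopsAfter {K : ℕ} (run : ℕ → RunState K) (R : ℕ) : Prop :=
  (∀ r < R, 1 < (run r).active.card) ∧ ¬ 1 < (run R).active.card

/-- A run stops and returns the arm `a`. -/
def Returns {K : ℕ} (run : ℕ → RunState K) (a : Fin K) : Prop :=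
  ∃ R, StopsAfter run R ∧ (run R).active = {a}

/-! ### Probability -/

/-- The reward laws `ν` have means `μ` and are `1`-subGaussian. -/
def IsSubGaussianInstance {K : ℕ} (ν : Fin K → Measure ℝ) (μ : Fin K → ℝ) : Prop :=
  ∀ a, ∫ x, x ∂(ν a) = μ a ∧ HasSubgaussianMGF (fun x => x - μ a) 1 (ν a)

/-- The law of the rewards without a channel: the rewards of all rounds and arms are independent,
and those of arm `a` have the law `ν a`. -/
def rewardLaw {K : ℕ} (ν : Fin K → Measure ℝ) : Measure (ℕ → Fin K → ℝ) :=
  Measure.infinitePi fun _ => Measure.pi ν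

/-- The joint law of the memoryless channel and the rewards: everything is independent, over rounds
as well, the output on input `v` has the law `W v`, and the reward of arm `a` has the law `ν a`. -/
def systemLaw {K : ℕ} (W : Fin K → PMF (Fin K)) (ν : Fin K → Measure ℝ) :
    Measure (ℕ → (Fin K → Fin K) × (Fin K → ℝ)) :=
  Measure.infinitePi fun _ => (Measure.pi fun v => (W v).toMeasure).prod (Measure.pi ν)

/-- The pull complexity of the clean phased successive elimination algorithm: the
least `N` such that, for all `1`-subGaussian reward laws with means `μ`, the algorithm stops within
`N` pulls with probability at least `1 - δ` (and `⊤` if there is no such `N`). -/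
def cleanComplexity {K : ℕ} (δ : ℝ) (μ : Fin K → ℝ) : ℕ∞ :=
  sInf {N : ℕ∞ | ∀ ν : Fin K → Measure ℝ, (∀ a, IsProbabilityMeasure (ν a)) →
    IsSubGaussianInstance ν μ →
    1 - δ ≤ (rewardLaw ν).real {x | ∃ R, StopsAfter (cleanRun δ x) R ∧
      ((cleanRun δ x R).pulled.length : ℕ∞) ≤ N}}

end PSE

end

namespace PSE

variable {K : ℕ}

/-! ### The stack model -/

/-! Active sets depend only on counted rewards, so the clean and the packetized algorithm are both
compared with a stack model, where the `t`-th counted reward of arm `a` is `y t a`. In a physical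
run that reward is read in a round that depends on the past and on the idle rounds. Still, `toStack`
carries the physical rewards to the stack one phase at a time: given the active set, which earlier
rows determine, it moves the later rewards of each arm by an injection of the time axis, and this
preserves the i.i.d. law. Hence the history of active sets has the same law whatever the idle times
are (`measure_delayed`).

The clean algorithm is a delayed run with no idle rounds. As channel outputs almost surely lie in
the support, zero-error decoding makes the packetized algorithm a delayed run with `n r` idle rounds
in phase `r` (`isDelayedRun_packet`). Its length is the number of counted pulls plus the idle
rounds, so every guarantee on counted pulls of the clean algorithm transfers.

What remains is the usual analysis in the stack model. With probability at least `1 - δ` all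
confidence intervals hold (`measureReal_concentrated`). Then the best arm is never eliminated, and
an arm with gap `Δ` that survives a phase has `Δ ≤ 4 β`; inverting this bounds its pulls
(`le_pullBound_of_le_radius`). -/

/-- The active sets of successive elimination if the `t`-th counted reward of arm `a` is `y t a`. -/
noncomputable def stackActive (δ : ℝ) (y : ℕ → Fin K → ℝ) : ℕ → Finset (Fin K)
  | 0 => Finset.univ
  | r + 1 =>
    if 1 < (stackActive δ y r).card then
      nextActive δ r (stackActive δ y r) fun a => ∑ t ∈ Finset.range (countedPulls r), y t a
    else stackActive δ y r

lemma countedPulls_eq (r : ℕ) : countedPulls r = (2 ^ r - 1) + 2 ^ r := by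
  have : 0 < 2 ^ r := by positivity
  rw [countedPulls, pow_succ]; omega

lemma nextActive_congr {δ : ℝ} {r : ℕ} {S : Finset (Fin K)} {f g : Fin K → ℝ}
    (h : ∀ a ∈ S, f a = g a) : nextActive δ r S f = nextActive δ r S g := by
  unfold nextActive
  refine Finset.filter_congr fun a ha => forall₂_congr fun b hb => ?_
  rw [h a ha, h b hb]

/-- Predictability: this is what allows the rearrangement of phase `r` to depend on the active set
while leaving that set unchanged. -/
lemma stackActive_congr {δ : ℝ} {y y' : ℕ → Fin K → ℝ} :
    ∀ {r : ℕ}, (∀ t < 2 ^ r - 1, y t = y' t) → stackActive δ y r = stackActive δ y' r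
  | 0, _ => rfl
  | r + 1, h => by
    have h0 : stackActive δ y r = stackActive δ y' r :=
      stackActive_congr fun t ht => h t (by rw [pow_succ]; omega)
    have h1 : (fun a => ∑ t ∈ Finset.range (countedPulls r), y t a) =
        fun a => ∑ t ∈ Finset.range (countedPulls r), y' t a := by
      funext a
      refine Finset.sum_congr rfl fun t ht => ?_
      rw [h t (Finset.mem_range.1 ht)]
    simp only [stackActive, h0, h1]

lemma measurableSet_stackActive_eq (δ : ℝ) :
    ∀ (r : ℕ) (S : Finset (Fin K)), MeasurableSet {y | stackActive δ y r = S}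
  | 0, S => by simp [stackActive]
  | r + 1, S => by
    have hE : {y : ℕ → Fin K → ℝ | stackActive δ y (r + 1) = S} =
        ⋃ T : Finset (Fin K), {y | stackActive δ y r = T} ∩
          {y | (if 1 < T.card then nextActive δ r T
            (fun a => ∑ t ∈ Finset.range (countedPulls r), y t a) else T) = S} := by
      ext y
      simp [stackActive]
    rw [hE]
    refine MeasurableSet.iUnion fun T => (measurableSet_stackActive_eq δ r T).inter ?_
    split_ifs with hT
    · simp only [nextActive, Finset.ext_iff, Finset.mem_filter]
      refine measurableSet_setOfPred.2 (Measurable.forall fun a => ?_)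
      refine Measurable.iff (measurable_const.and ?_) measurable_const
      refine Measurable.forall fun b => Measurable.forall fun _ => measurableSet_setOfPred.1 ?_
      refine measurableSet_le ?_ ?_ <;> fun_prop
    · exact MeasurableSet.const _

lemma measurableSet_history (δ : ℝ) (R : ℕ) {E : (ℕ → Finset (Fin K)) → Prop}
    (hE : ∀ s s', (∀ j ≤ R, s j = s' j) → E s → E s') :
    MeasurableSet {y : ℕ → Fin K → ℝ | E (stackActive δ y)} := by
  -- A history up to `R` has finitely many possible values; `min j R` extends one to a full
  -- sequence, whose tail `E` ignores.
  have h : {y : ℕ → Fin K → ℝ | E (stackActive δ y)} =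
      ⋃ v : {v : Fin (R + 1) → Finset (Fin K) // E fun j => v ⟨min j R, by omega⟩},
        ⋂ j : Fin (R + 1), {y | stackActive δ y j = v.1 j} := by
    ext y
    simp only [Set.mem_ofPred_eq, Set.mem_iUnion, Set.mem_iInter, Subtype.exists, exists_prop]
    constructor
    · exact fun hy => ⟨fun j => stackActive δ y j, hE _ _ (fun j hj => by simp [hj]) hy, by simp⟩
    · rintro ⟨v, hv, hy⟩
      refine hE _ _ (fun j hj => ?_) hv
      have := hy ⟨j, by omega⟩
      simp [hj, this]
  rw [h]
  exact MeasurableSet.iUnion fun v => MeasurableSet.iInter fun j =>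
    measurableSet_stackActive_eq δ _ _

/-! ### Rearrangements of the rewards -/

/-- For each arm the rewards are i.i.d. over time, so reading them along an injective sequence of
times keeps the law; surjectivity is not needed, and skipped rewards are dropped. -/
lemma measurePreserving_reindex (ν : Fin K → Measure ℝ) [∀ a, IsProbabilityMeasure (ν a)]
    {p : Fin K → ℕ → ℕ} (hp : ∀ a, Function.Injective (p a)) :
    MeasurePreserving (fun (y : ℕ → Fin K → ℝ) t a => y (p a t) a)
      (rewardLaw ν) (rewardLaw ν) := by
  refine ⟨by fun_prop, ?_⟩
  have h1 : rewardLaw ν = (Measure.infinitePi fun q : ℕ × Fin K => ν q.2).map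
      (MeasurableEquiv.curry ℕ (Fin K) ℝ) := by
    rw [Measure.infinitePi_map_curry (fun (_ : ℕ) a => ν a), rewardLaw]
    simp_rw [Measure.infinitePi_eq_pi]
  have hf : Function.Injective fun q : ℕ × Fin K => (p q.2 q.1, q.2) := by
    rintro ⟨t, a⟩ ⟨t', a'⟩ h
    simp only [Prod.mk.injEq] at h
    obtain ⟨h, rfl⟩ := h
    rw [hp a h]
  rw [h1, Measure.map_map (by fun_prop) (by fun_prop)]
  conv_rhs => rw [← Measure.map_infinitePi_infinitePi_of_inj
    (P := fun q : ℕ × Fin K => ν q.2) hf]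
  rw [Measure.map_map (by fun_prop) (by fun_prop)]
  rfl

/-- Since no `g i` changes the label `c`, the preimage of `A` is the disjoint union of the preimages
under `g i` of the part of `A` with label `i`, and each piece keeps its measure. -/
lemma measurePreserving_of_partition {Ω ι : Type*} [MeasurableSpace Ω] [Countable ι]
    {ρ : Measure Ω} {c : Ω → ι} (hc : ∀ i, MeasurableSet {y | c y = i}) {g : ι → Ω → Ω}
    (hg : ∀ i, MeasurePreserving (g i) ρ ρ) (hcg : ∀ i y, c (g i y) = c y) :
    MeasurePreserving (fun y => g (c y) y) ρ ρ := by
  have hpre (A : Set Ω) :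
      (fun y => g (c y) y) ⁻¹' A = ⋃ i, g i ⁻¹' ({y | c y = i} ∩ A) := by
    ext y; simp [hcg]
  have hm : Measurable fun y => g (c y) y := fun A hA => by
    rw [hpre]
    exact MeasurableSet.iUnion fun i => (hg i).measurable ((hc i).inter hA)
  refine ⟨hm, Measure.ext fun A hA => ?_⟩
  have hA' : A = ⋃ i, ({y | c y = i} ∩ A) := by ext y; simp
  rw [Measure.map_apply hm hA, hpre, measure_iUnion _ fun i => (hg i).measurable ((hc i).inter hA)]
  · conv_rhs => rw [hA', measure_iUnion
      (fun i j hij => Set.disjoint_left.2 fun y hi hj => hij (hi.1.symm.trans hj.1))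
      fun i => (hc i).inter hA]
    exact tsum_congr fun i => (hg i).measure_preimage ((hc i).inter hA).nullMeasurableSet
  · intro i j hij
    refine Set.disjoint_left.2 fun y hi hj => hij ?_
    have h1 : c (g i y) = i := hi.1
    have h2 : c (g j y) = j := hj.1
    rw [hcg] at h1 h2
    exact h1.symm.trans h2

/-- In a phase with active set `S` that starts after `2 ^ r - 1` rounds and begins with `d` idle
rounds, the round of the `t`-th counted pull of arm `a`. -/
noncomputable def slotTime (d r : ℕ) (S : Finset (Fin K)) (a : Fin K) (t : ℕ) : ℕ :=
  if t < 2 ^ r - 1 then t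
  else if t < countedPulls r then d + (if a ∈ S then S.sort.idxOf a else 0) * 2 ^ r + t
  else t + d + S.card * 2 ^ r - 2 ^ r

/-- Old rows stay, the rows of the phase go into one block among the next `d + S.card * 2 ^ r`
rounds, and later rows go behind these rounds. Arms outside `S` get the dummy block `0`, which
exists because `S` is nonempty. -/
lemma slotTime_injective {d r : ℕ} {S : Finset (Fin K)} (hS : 0 < S.card) (a : Fin K) :
    Function.Injective (slotTime d r S a) := by
  have h1 : ((if a ∈ S then S.sort.idxOf a else 0) + 1) * 2 ^ r ≤ S.card * 2 ^ r := by
    refine Nat.mul_le_mul_right _ ?_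
    split_ifs with h
    · have : S.sort.idxOf a < S.sort.length := List.idxOf_lt_length_iff.2 (by simpa using h)
      simpa using this
    · omega
  have h2 : 0 < 2 ^ r := by positivity
  intro t t' h
  unfold slotTime at h
  rw [add_mul] at h1
  have := countedPulls_eq r
  generalize (if a ∈ S then S.sort.idxOf a else 0) * 2 ^ r = u at *
  split_ifs at h <;> omega

/-- Moves the rewards of the phase `r`, which begins with `d` idle rounds, to the stack. -/
noncomputable def rearrange (δ : ℝ) (d r : ℕ) (y : ℕ → Fin K → ℝ) : ℕ → Fin K → ℝ :=
  if 1 < (stackActive δ y r).card then fun t a => y (slotTime d r (stackActive δ y r) a t) a else y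

lemma rearrange_of_lt (δ : ℝ) (d r : ℕ) (y : ℕ → Fin K → ℝ) {t : ℕ} (ht : t < 2 ^ r - 1) :
    rearrange δ d r y t = y t := by
  unfold rearrange
  split_ifs
  · simp [slotTime, ht]
  · rfl

lemma measurePreserving_rearrange (ν : Fin K → Measure ℝ) [∀ a, IsProbabilityMeasure (ν a)]
    (δ : ℝ) (d r : ℕ) : MeasurePreserving (rearrange δ d r) (rewardLaw ν) (rewardLaw ν) := by
  refine measurePreserving_of_partition (c := fun y => stackActive δ y r)
    (g := fun S y => if 1 < S.card then fun t a => y (slotTime d r S a t) a else y)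
    (measurableSet_stackActive_eq δ r) (fun S => ?_) fun S y => ?_
  · split_ifs with hS
    · exact measurePreserving_reindex ν (p := slotTime d r S)
        fun a => slotTime_injective (by omega) a
    · exact MeasurePreserving.id _
  · refine stackActive_congr fun t ht => ?_
    split_ifs
    · simp [slotTime, ht]
    · rfl

/-- The rewards of the first `r` phases of a run with `n j` idle rounds at the start of phase `j`,
moved to the stack; the rewards of the later rounds follow. -/
noncomputable def toStack (δ : ℝ) (n : ℕ → ℕ) : ℕ → (ℕ → Fin K → ℝ) → ℕ → Fin K → ℝ
  | 0, x => x
  | r + 1, x => rearrange δ (n r) r (toStack δ n r x)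

lemma measurePreserving_toStack (ν : Fin K → Measure ℝ) [∀ a, IsProbabilityMeasure (ν a)]
    (δ : ℝ) (n : ℕ → ℕ) :
    ∀ r, MeasurePreserving (toStack δ n r) (rewardLaw ν) (rewardLaw ν)
  | 0 => MeasurePreserving.id _
  | r + 1 => (measurePreserving_rearrange ν δ (n r) r).comp (measurePreserving_toStack ν δ n r)

/-- The active set after `r` phases of a run with `n j` idle rounds at the start of phase `j`. -/
noncomputable def delayedActive (δ : ℝ) (n : ℕ → ℕ) (x : ℕ → Fin K → ℝ) (r : ℕ) : Finset (Fin K) :=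
  stackActive δ (toStack δ n r x) r

/-- Rearrangements of later phases fix all the rows that phase `j` has already used. -/
lemma stackActive_toStack (δ : ℝ) (n : ℕ → ℕ) (x : ℕ → Fin K → ℝ) {j R : ℕ} (h : j ≤ R) :
    stackActive δ (toStack δ n R x) j = delayedActive δ n x j := by
  induction R, h using Nat.le_induction with
  | base => rfl
  | succ R h ih =>
    rw [← ih]
    refine stackActive_congr fun t ht => rearrange_of_lt _ _ _ _ (ht.trans_le ?_)
    exact Nat.sub_le_sub_right (Nat.pow_le_pow_right (by norm_num) h) 1

lemma measurableSet_delayed {δ : ℝ} {n : ℕ → ℕ} {R : ℕ} {E : (ℕ → Finset (Fin K)) → Prop}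
    (hE : ∀ s s', (∀ j ≤ R, s j = s' j) → E s → E s') (ν : Fin K → Measure ℝ)
    [∀ a, IsProbabilityMeasure (ν a)] :
    MeasurableSet {x | E (delayedActive δ n x)} ∧
      rewardLaw ν {x | E (delayedActive δ n x)} = rewardLaw ν {y | E (stackActive δ y)} := by
  have h : {x | E (delayedActive δ n x)} = toStack δ n R ⁻¹' {y | E (stackActive δ y)} := by
    ext x
    exact ⟨hE _ _ fun j hj => (stackActive_toStack δ n x hj).symm,
      hE _ _ fun j hj => stackActive_toStack δ n x hj⟩
  have hm := measurableSet_history δ R hE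
  rw [h]
  exact ⟨(measurePreserving_toStack ν δ n R).measurable hm,
    (measurePreserving_toStack ν δ n R).measure_preimage hm.nullMeasurableSet⟩

/-- An event about the history up to some stopping phase is as likely in a delayed run as in the
stack model. -/
lemma measure_delayed {δ : ℝ} {n : ℕ → ℕ} {E : ℕ → (ℕ → Finset (Fin K)) → Prop}
    (hE : ∀ R s s', (∀ j ≤ R, s j = s' j) → E R s → E R s') (ν : Fin K → Measure ℝ)
    [∀ a, IsProbabilityMeasure (ν a)] :
    MeasurableSet {x | ∃ R, E R (delayedActive δ n x)} ∧
      rewardLaw ν {x | ∃ R, E R (delayedActive δ n x)} =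
        rewardLaw ν {y | ∃ R, E R (stackActive δ y)} := by
  have hE' (R : ℕ) : ∀ s s' : ℕ → Finset (Fin K), (∀ j ≤ R, s j = s' j) →
      (∃ j ≤ R, E j s) → ∃ j ≤ R, E j s' := fun s s' h ⟨j, hj, hs⟩ =>
    ⟨j, hj, hE j s s' (fun i hi => h i (hi.trans hj)) hs⟩
  -- `toStack` is faithful only up to a finite phase, so the event is exhausted by increasing events
  -- about finite histories and continuity from below is used.
  have key (f : (ℕ → Fin K → ℝ) → ℕ → Finset (Fin K)) :
      {x | ∃ R, E R (f x)} = ⋃ R, {x | ∃ j ≤ R, E j (f x)} := by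
    ext x
    simp only [Set.mem_ofPred_eq, Set.mem_iUnion]
    exact ⟨fun ⟨R, h⟩ => ⟨R, R, le_rfl, h⟩, fun ⟨_, j, _, h⟩ => ⟨j, h⟩⟩
  have mono (f : (ℕ → Fin K → ℝ) → ℕ → Finset (Fin K)) :
      Monotone fun R => {x | ∃ j ≤ R, E j (f x)} :=
    fun R R' h x ⟨j, hj, hx⟩ => ⟨j, hj.trans h, hx⟩
  rw [key, key, (mono _).measure_iUnion, (mono _).measure_iUnion]
  exact ⟨MeasurableSet.iUnion fun R => (measurableSet_delayed (hE' R) ν).1,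
    iSup_congr fun R => (measurableSet_delayed (hE' R) ν).2⟩

/-! ### Delayed runs -/

lemma planSlot_eq_some_iff {S : Finset (Fin K)} {m k : ℕ} {a : Fin K} :
    planSlot S m k = some a ↔ a ∈ S ∧ k / m = S.sort.idxOf a := by
  unfold planSlot
  rw [List.getElem?_eq_some_iff]
  constructor
  · rintro ⟨h, rfl⟩
    exact ⟨by rw [← Finset.mem_sort (· ≤ ·)]; exact List.getElem_mem h,
      ((S.sort_nodup (· ≤ ·)).idxOf_getElem _ h).symm⟩
  · rintro ⟨h, h'⟩
    have hl : S.sort.idxOf a < S.sort.length := List.idxOf_lt_length_iff.2 (by simpa using h)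
    refine ⟨h' ▸ hl, ?_⟩
    simp_rw [h']
    exact List.getElem_idxOf hl

lemma exists_planSlot_eq_some {S : Finset (Fin K)} {m k : ℕ} (hk : k < S.card * m) :
    ∃ a, planSlot S m k = some a := by
  have h : k / m < S.sort.length := by
    rw [Finset.length_sort]
    exact Nat.div_lt_of_lt_mul (by rwa [mul_comm])
  exact ⟨_, List.getElem?_eq_getElem h⟩

/-- The slots of an arm form a contiguous block of length `m`, placed by its rank in `S`. -/
lemma sum_planSlot {S : Finset (Fin K)} {m : ℕ} {a : Fin K} (ha : a ∈ S) (f : ℕ → ℝ) :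
    ∑ k ∈ Finset.range (S.card * m), (if planSlot S m k = some a then f k else 0) =
      ∑ i ∈ Finset.range m, f (S.sort.idxOf a * m + i) := by
  rw [← Finset.sum_filter]
  have hl : S.sort.idxOf a + 1 ≤ S.card := by
    have : S.sort.idxOf a < S.sort.length := List.idxOf_lt_length_iff.2 (by simpa using ha)
    simpa using this
  have hl' := Nat.mul_le_mul_right m hl
  rw [add_mul] at hl'
  symm
  refine Finset.sum_nbij (fun i => S.sort.idxOf a * m + i) ?_ ?_ ?_ fun _ _ => rfl
  · intro i hi
    have hi := Finset.mem_range.1 hi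
    rw [Finset.mem_filter, Finset.mem_range, planSlot_eq_some_iff]
    refine ⟨by omega, ha, ?_⟩
    rw [mul_comm, Nat.mul_add_div (by omega), Nat.div_eq_of_lt hi, add_zero]
  · intro i _ j _ h
    simpa using h
  · intro k hk
    simp only [Finset.coe_filter, Finset.mem_range, Set.mem_ofPred_eq, planSlot_eq_some_iff] at hk
    have hm : 0 < m := Nat.pos_of_ne_zero fun h => by simp [h] at hk
    exact ⟨k % m, by simpa using Nat.mod_lt k hm, by
      simp only [← hk.2.2]; exact Nat.div_add_mod' k m⟩

/-- A run of successive elimination on the rewards `x` in which phase `r` begins with `n r` idle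
rounds. -/
structure IsDelayedRun (δ : ℝ) (n : ℕ → ℕ) (x : ℕ → Fin K → ℝ) (run : ℕ → RunState K) : Prop where
  zero : run 0 = RunState.init K
  halted : ∀ r, ¬ 1 < (run r).active.card → run (r + 1) = run r
  active : ∀ r, 1 < (run r).active.card →
    (run (r + 1)).active = nextActive δ r (run r).active (run (r + 1)).total
  total : ∀ r, 1 < (run r).active.card → ∀ a, (run (r + 1)).total a = (run r).total a +
    ∑ k ∈ Finset.range ((run r).active.card * 2 ^ r),
      if planSlot (run r).active (2 ^ r) k = some a
        then x ((run r).pulled.length + n r + k) a else 0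
  pulled : ∀ r, 1 < (run r).active.card → (run (r + 1)).pulled.length =
    (run r).pulled.length + n r + (run r).active.card * 2 ^ r

lemma nextActive_subset (δ : ℝ) (r : ℕ) (S : Finset (Fin K)) (f : Fin K → ℝ) :
    nextActive δ r S f ⊆ S := Finset.filter_subset _ _

/-- The induction must also record that the stack rows not yet used are exactly the rewards of the
physical rounds still to come. Totals are compared on active arms only: for an eliminated arm the
stack contains rewards that were never counted. -/
lemma IsDelayedRun.invariant {δ : ℝ} {n : ℕ → ℕ} {x : ℕ → Fin K → ℝ} {run : ℕ → RunState K}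
    (h : IsDelayedRun δ n x run) (r : ℕ) :
    (run r).active = delayedActive δ n x r ∧ (1 < (run r).active.card →
      (∀ a ∈ (run r).active,
        (run r).total a = ∑ t ∈ Finset.range (2 ^ r - 1), toStack δ n r x t a) ∧
      ∀ t a, toStack δ n r x (2 ^ r - 1 + t) a = x ((run r).pulled.length + t) a) := by
  induction r with
  | zero => simp [h.zero, RunState.init, delayedActive, stackActive, toStack]
  | succ r ih =>
    obtain ⟨hact, ih⟩ := ih
    by_cases hr : 1 < (run r).active.card
    · obtain ⟨htot, hres⟩ := ih hr
      have hS : stackActive δ (toStack δ n (r + 1) x) r = (run r).active := by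
        rw [hact, stackActive_toStack δ n x r.le_succ]
      have hpow : 0 < 2 ^ r := by positivity
      have hc := countedPulls_eq r
      have hstep : toStack δ n (r + 1) x = fun t a =>
          toStack δ n r x (slotTime (n r) r (run r).active a t) a := by
        have : stackActive δ (toStack δ n r x) r = (run r).active := hact.symm
        simp only [toStack, rearrange, this, hr, if_true]
      have htot' : ∀ a ∈ (run r).active, (run (r + 1)).total a =
          ∑ t ∈ Finset.range (countedPulls r), toStack δ n (r + 1) x t a := by
        intro a ha
        rw [h.total r hr, sum_planSlot ha (fun k => x ((run r).pulled.length + n r + k) a),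
          htot a ha, hc, Finset.sum_range_add]
        congr 1
        · refine Finset.sum_congr rfl fun t ht => ?_
          rw [toStack, rearrange_of_lt _ _ _ _ (Finset.mem_range.1 ht)]
        · refine Finset.sum_congr rfl fun i hi => ?_
          have hi := Finset.mem_range.1 hi
          rw [hstep]
          simp only [slotTime, ha, if_true]
          rw [if_neg (by omega), if_pos (by omega), show n r + ((run r).active.sort (· ≤ ·)).idxOf a * 2 ^ r + (2 ^ r - 1 + i) =
            2 ^ r - 1 + (n r + ((run r).active.sort (· ≤ ·)).idxOf a * 2 ^ r + i) by omega, hres]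
          congr 1
          omega
      refine ⟨?_, fun _ => ⟨fun a ha => ?_, fun t a => ?_⟩⟩
      · rw [h.active r hr, nextActive_congr htot', delayedActive, stackActive, hS, if_pos hr]
      · rw [h.active r hr] at ha
        exact htot' a (nextActive_subset _ _ _ _ ha)
      -- The phase takes `n r + card * 2 ^ r` physical rounds but adds only `2 ^ r` stack rows; the
      -- last case of `slotTime` makes up the difference.
      · have h1 : 2 ^ (r + 1) - 1 = countedPulls r := rfl
        have h2 := Nat.mul_le_mul_right (2 ^ r) hr.le
        rw [hstep, h.pulled r hr, h1]
        simp only [slotTime]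
        rw [if_neg (by omega), if_neg (by omega), show countedPulls r + t + n r +
          (run r).active.card * 2 ^ r - 2 ^ r =
          2 ^ r - 1 + (n r + (run r).active.card * 2 ^ r + t) by omega, hres]
        congr 1
        omega
    · have hr' : ¬ 1 < (stackActive δ (toStack δ n r x) r).card := by
        rwa [← delayedActive, ← hact]
      refine ⟨?_, fun h' => absurd (h.halted r hr ▸ h') hr⟩
      rw [h.halted r hr, hact, delayedActive, delayedActive, toStack, rearrange, if_neg hr',
        stackActive, if_neg hr']

lemma IsDelayedRun.active_eq {δ : ℝ} {n : ℕ → ℕ} {x : ℕ → Fin K → ℝ} {run : ℕ → RunState K}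
    (h : IsDelayedRun δ n x run) (r : ℕ) : (run r).active = delayedActive δ n x r :=
  (h.invariant r).1

lemma IsDelayedRun.length_pulled {δ : ℝ} {n : ℕ → ℕ} {x : ℕ → Fin K → ℝ}
    {run : ℕ → RunState K} (h : IsDelayedRun δ n x run) (R : ℕ)
    (hR : ∀ r < R, 1 < (run r).active.card) :
    (run R).pulled.length =
      ∑ r ∈ Finset.range R, (run r).active.card * 2 ^ r + ∑ r ∈ Finset.range R, n r := by
  induction R with
  | zero => simp [h.zero, RunState.init]
  | succ R ih =>
    rw [h.pulled R (hR R R.lt_succ_self), ih fun r hr => hR r (hr.trans R.lt_succ_self),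
      Finset.sum_range_succ, Finset.sum_range_succ]
    ring

lemma length_filterMap_planSlot (S : Finset (Fin K)) (m : ℕ) :
    ((List.range (S.card * m)).filterMap (planSlot S m)).length = S.card * m := by
  rw [List.length_filterMap_eq_countP, List.countP_eq_length.2, List.length_range]
  intro k hk
  obtain ⟨a, ha⟩ := exists_planSlot_eq_some (List.mem_range.1 hk)
  simp [ha]

lemma isDelayedRun_clean (δ : ℝ) (x : ℕ → Fin K → ℝ) :
    IsDelayedRun δ (fun _ => 0) x (cleanRun δ x) where
  zero := rfl
  halted r hr := by rw [cleanRun, if_neg hr]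
  active r hr := by rw [cleanRun, if_pos hr]; rfl
  total r hr a := by
    rw [cleanRun, if_pos hr]
    simp only [cleanPhase, addRewards, budget]
    congr 1
    refine Finset.sum_congr rfl fun k _ => ?_
    split_ifs with h
    · simp [h]
    · rfl
  pulled r hr := by
    rw [cleanRun, if_pos hr]
    simp only [cleanPhase, List.length_append, length_filterMap_planSlot, budget, add_zero]

/-- If the channel outputs are possible ones and all plans that are sent belong to the plan
families, then all plans are decoded correctly. -/
lemma isDelayedRun_packet {W : Fin K → PMF (Fin K)} (δ : ℝ) {P : ℕ → Finset (Finset (Fin K))}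
    {n : ℕ → ℕ} (code : ∀ r, ZeroErrorPacket W (P r) (n r)) (h₀ : Fin K)
    (ω : ℕ → (Fin K → Fin K) × (Fin K → ℝ)) (hω : ∀ t v, (ω t).1 v ∈ (W v).support)
    (hP : ∀ r, 1 < (packetRun δ code h₀ ω r).active.card →
      (packetRun δ code h₀ ω r).active ∈ P r) :
    IsDelayedRun δ n (fun t => (ω t).2) (packetRun δ code h₀ ω) where
  zero := rfl
  halted r hr := by rw [packetRun, if_neg hr]
  active r hr := by rw [packetRun, if_pos hr]; rfl
  total r hr a := by
    rw [packetRun, if_pos hr]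
    simp only [packetPhase, addRewards, budget]
    congr 1
    refine Finset.sum_congr rfl fun k _ => ?_
    split_ifs with h
    · rw [(code r).zero_error _ (hP r hr) _ fun i => hω _ _, h]
      rfl
    · rfl
  pulled r hr := by
    rw [packetRun, if_pos hr]
    simp [packetPhase, budget, add_assoc]

/-! ### Zero-error packets -/

/-- Plans are injected into a maximum independent set. Two codewords with a common possible output
would be adjacent in the strong power, so an output is consistent with at most one plan and the
decoder selects it. -/
theorem nonempty_zeroErrorPacket {W : Fin K → PMF (Fin K)} (hK : 0 < K)
    {P : Finset (Finset (Fin K))} {n : ℕ}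
    (h : P.card ≤ (strongPower (confusabilityGraph W) n).indepNum) :
    Nonempty (ZeroErrorPacket W P n) := by
  classical
  have : Nonempty (Fin K) := ⟨⟨0, hK⟩⟩
  obtain ⟨I, hI⟩ := (strongPower (confusabilityGraph W) n).exists_isNIndepSet_indepNum
  obtain ⟨f, hf, hinj⟩ := P.finite_toSet.exists_injOn_of_encard_le
    (t := (I : Set (Fin n → Fin K)))
    (by simpa only [Set.encard_coe_eq_coe_finsetCard, Nat.cast_le, hI.card_eq] using h)
  have key : ∀ S ∈ P, ∀ T ∈ P, ∀ y : Fin n → Fin K, (∀ i, y i ∈ (W (f S i)).support) →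
      (∀ i, y i ∈ (W (f T i)).support) → S = T := by
    intro S hS T hT y hyS hyT
    by_contra hST
    have hne : f S ≠ f T := fun e => hST (hinj hS hT e)
    refine hI.isIndepSet (hf hS) (hf hT) hne ⟨hne, fun i => ?_⟩
    by_cases hi : f S i = f T i
    · exact Or.inl hi
    · exact Or.inr ⟨hi, y i, hyS i, hyT i⟩
  refine ⟨⟨f, fun y => if hy : ∃ S ∈ P, ∀ i, y i ∈ (W (f S i)).support then hy.choose else ∅,
    fun S hS y hy => ?_⟩⟩
  have hex : ∃ S ∈ P, ∀ i, y i ∈ (W (f S i)).support := ⟨S, hS, hy⟩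
  rw [dif_pos hex]
  exact key _ hex.choose_spec.1 _ hS y hex.choose_spec.2 hy

/-! ### Concentration -/

/-- All confidence intervals of the stack model are correct. -/
def Concentrated (δ : ℝ) (μ : Fin K → ℝ) (y : ℕ → Fin K → ℝ) : Prop :=
  ∀ r a, |(∑ t ∈ Finset.range (countedPulls r), y t a) / countedPulls r - μ a| ≤
    radius K δ (countedPulls r)

instance (ν : Fin K → Measure ℝ) [∀ a, IsProbabilityMeasure (ν a)] :
    IsProbabilityMeasure (rewardLaw ν) := by
  unfold rewardLaw
  infer_instance

lemma measurePreserving_eval_rewardLaw (ν : Fin K → Measure ℝ) [∀ a, IsProbabilityMeasure (ν a)]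
    (t : ℕ) (a : Fin K) :
    MeasurePreserving (fun y : ℕ → Fin K → ℝ => y t a) (rewardLaw ν) (ν a) :=
  (measurePreserving_eval ν a).comp
    (measurePreserving_eval_infinitePi (fun _ : ℕ => Measure.pi ν) t)

lemma two_pow_le_countedPulls (r : ℕ) : 2 ^ r ≤ countedPulls r := by
  rw [countedPulls_eq]; omega

lemma countedPulls_pos (r : ℕ) : 0 < countedPulls r :=
  (by positivity : 0 < 2 ^ r).trans_le (two_pow_le_countedPulls r)

lemma one_le_log_arg {δ : ℝ} (h0 : 0 < δ) (h1 : δ < 1) (hK : 0 < K) {t : ℕ} (ht : 0 < t) :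
    1 ≤ 8 * K * (t : ℝ) ^ 2 / δ := by
  rw [le_div_iff₀ h0]
  have h2 : (1 : ℝ) ≤ K := by exact_mod_cast hK
  have h3 : (1 : ℝ) ≤ (t : ℝ) ^ 2 := one_le_pow₀ (by exact_mod_cast ht)
  nlinarith [mul_le_mul h2 h3 zero_le_one (by positivity)]

lemma radius_sq {δ : ℝ} (h0 : 0 < δ) (h1 : δ < 1) (hK : 0 < K) {t : ℕ} (ht : 0 < t) :
    radius K δ t ^ 2 = 2 * Real.log (8 * K * (t : ℝ) ^ 2 / δ) / t := by
  have := Real.log_nonneg (one_le_log_arg h0 h1 hK ht)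
  rw [radius, Real.sq_sqrt (by positivity)]

/-- The radius is tuned so that the Hoeffding exponent `(T β)² / (2 T)` is exactly the logarithm in
its definition. -/
lemma measureReal_sum_ge_le {δ : ℝ} (h0 : 0 < δ) (h1 : δ < 1) (hK : 0 < K) {Ω : Type*}
    [MeasurableSpace Ω] {ρ : Measure Ω} {X : ℕ → Ω → ℝ} (hX : iIndepFun X ρ)
    (hs : ∀ t, HasSubgaussianMGF (X t) 1 ρ) {T : ℕ} (hT : 0 < T) :
    ρ.real {ω | T * radius K δ T ≤ ∑ t ∈ Finset.range T, X t ω} ≤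
      δ / (8 * K * (T : ℝ) ^ 2) := by
  have hT' : (0 : ℝ) < T := by exact_mod_cast hT
  have hl := one_le_log_arg h0 h1 hK hT
  refine (HasSubgaussianMGF.measure_sum_range_ge_le_of_iIndepFun hX (fun t _ => hs t)
    (ε := T * radius K δ T) (mul_nonneg hT'.le (Real.sqrt_nonneg _))).trans_eq ?_
  have : -(T * radius K δ T) ^ 2 / (2 * T * (1 : NNReal)) =
      -Real.log (8 * K * (T : ℝ) ^ 2 / δ) := by
    rw [mul_pow, radius_sq h0 h1 hK hT]
    push_cast
    field_simp
  rw [this, Real.exp_neg, Real.exp_log (by linarith), inv_div]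

lemma measureReal_deviation_le {δ : ℝ} (h0 : 0 < δ) (h1 : δ < 1) {ν : Fin K → Measure ℝ}
    {μ : Fin K → ℝ} [∀ a, IsProbabilityMeasure (ν a)] (hν : IsSubGaussianInstance ν μ)
    (a : Fin K) {T : ℕ} (hT : 0 < T) :
    (rewardLaw ν).real {y | ¬ |(∑ t ∈ Finset.range T, y t a) / T - μ a| ≤ radius K δ T} ≤
      δ / (4 * K * (T : ℝ) ^ 2) := by
  have hK : 0 < K := a.pos
  have hT' : (0 : ℝ) < T := by exact_mod_cast hT
  have hi : iIndepFun (fun t (y : ℕ → Fin K → ℝ) => y t a - μ a) (rewardLaw ν) :=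
    iIndepFun_infinitePi (P := fun _ : ℕ => Measure.pi ν) (X := fun _ z => z a - μ a)
      fun _ => by fun_prop
  have hs (t : ℕ) : HasSubgaussianMGF (fun y : ℕ → Fin K → ℝ => y t a - μ a) 1 (rewardLaw ν) :=
    HasSubgaussianMGF.of_map (Y := fun y : ℕ → Fin K → ℝ => y t a) (X := fun z => z - μ a)
      (measurePreserving_eval_rewardLaw ν t a).aemeasurable
      (by rw [(measurePreserving_eval_rewardLaw ν t a).map_eq]; exact (hν a).2)
  have hi' : iIndepFun (fun t (y : ℕ → Fin K → ℝ) => -(y t a - μ a)) (rewardLaw ν) :=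
    iIndepFun_infinitePi (P := fun _ : ℕ => Measure.pi ν) (X := fun _ z => -(z a - μ a))
      fun _ => by fun_prop
  have b1 := measureReal_sum_ge_le h0 h1 hK hi hs hT
  have b2 := measureReal_sum_ge_le h0 h1 hK hi' (fun t => (hs t).neg) hT
  refine ((measureReal_mono ?_ (by finiteness)).trans
    (measureReal_union_le _ _)).trans ((add_le_add b1 b2).trans_eq (by field_simp; norm_num))
  intro y hy
  have hsum : (∑ t ∈ Finset.range T, y t a) / T - μ a =
      (∑ t ∈ Finset.range T, (y t a - μ a)) / T := by
    rw [Finset.sum_sub_distrib, Finset.sum_const, Finset.card_range, nsmul_eq_mul]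
    field_simp
  rw [Set.mem_ofPred_eq, hsum, not_le, lt_abs, ← neg_div, lt_div_iff₀' hT', lt_div_iff₀' hT',
    ← Finset.sum_neg_distrib] at hy
  exact hy.imp le_of_lt le_of_lt

theorem measureReal_concentrated {δ : ℝ} (h0 : 0 < δ) (h1 : δ < 1) {ν : Fin K → Measure ℝ}
    {μ : Fin K → ℝ} [∀ a, IsProbabilityMeasure (ν a)] (hν : IsSubGaussianInstance ν μ) :
    1 - δ ≤ (rewardLaw ν).real {y | Concentrated δ μ y} := by
  set bad : ℕ → Fin K → Set (ℕ → Fin K → ℝ) := fun r a =>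
    {y | ¬ |(∑ t ∈ Finset.range (countedPulls r), y t a) / countedPulls r - μ a| ≤
      radius K δ (countedPulls r)} with hbad
  have hphase (r : ℕ) : rewardLaw ν (⋃ a, bad r a) ≤ ENNReal.ofReal (δ / 2 / 2 ^ r) := by
    have hT : (0 : ℝ) < countedPulls r := by exact_mod_cast countedPulls_pos r
    calc rewardLaw ν (⋃ a, bad r a) ≤ ∑ a, rewardLaw ν (bad r a) := measure_iUnion_fintype_le _ _
      _ ≤ ∑ a : Fin K, ENNReal.ofReal (δ / (4 * K * (countedPulls r : ℝ) ^ 2)) := by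
        refine Finset.sum_le_sum fun a _ => ?_
        rw [← ofReal_measureReal]
        exact ENNReal.ofReal_le_ofReal
          (measureReal_deviation_le h0 h1 hν a (countedPulls_pos r))
      _ = ENNReal.ofReal (K * (δ / (4 * K * (countedPulls r : ℝ) ^ 2))) := by
        rw [Finset.sum_const, Finset.card_univ, Fintype.card_fin, nsmul_eq_mul,
          ENNReal.ofReal_mul (by positivity), ENNReal.ofReal_natCast]
      _ ≤ ENNReal.ofReal (δ / 2 / 2 ^ r) := by
        refine ENNReal.ofReal_le_ofReal ?_
        rcases K.eq_zero_or_pos with rfl | hK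
        · simp only [Nat.cast_zero, zero_mul]; positivity
        have hK' : (0 : ℝ) < K := by exact_mod_cast hK
        have hle : (2 : ℝ) ^ r ≤ countedPulls r := by exact_mod_cast two_pow_le_countedPulls r
        have h2 : (1 : ℝ) ≤ 2 ^ r := one_le_pow₀ (by norm_num)
        have e : K * (δ / (4 * K * (countedPulls r : ℝ) ^ 2)) =
            δ / (4 * (countedPulls r : ℝ) ^ 2) := by field_simp
        -- The union over `K` arms leaves `δ / (4 T²)`; with `T ≥ 2 ^ r` this is below a geometric
        -- sequence of sum `δ`.
        rw [e, div_div]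
        refine div_le_div_of_nonneg_left h0.le (by positivity) ?_
        nlinarith
  have hsub : {y | Concentrated δ μ y}ᶜ ⊆ ⋃ r, ⋃ a, bad r a := by
    intro y hy
    simpa [Concentrated, hbad] using hy
  have hle : rewardLaw ν {y | Concentrated δ μ y}ᶜ ≤ ENNReal.ofReal δ :=
    calc _ ≤ _ := measure_mono hsub
      _ ≤ ∑' r, rewardLaw ν (⋃ a, bad r a) := measure_iUnion_le _
      _ ≤ ∑' r : ℕ, ENNReal.ofReal (δ / 2 / 2 ^ r) := ENNReal.tsum_le_tsum hphase
      _ = ENNReal.ofReal δ := by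
        rw [← ENNReal.ofReal_tsum_of_nonneg (fun r => by positivity)
          (summable_geometric_two' δ), tsum_geometric_two']
  have hle' : (rewardLaw ν).real {y | Concentrated δ μ y}ᶜ ≤ δ :=
    ENNReal.toReal_le_of_le_ofReal h0.le hle
  -- Subadditivity gives the bound without measurability of the event.
  have huniv := measureReal_union_le (μ := rewardLaw ν) {y | Concentrated δ μ y}
    {y | Concentrated δ μ y}ᶜ
  rw [Set.union_compl_self, probReal_univ] at huniv
  linarith

/-! ### Analysis of the stack model -/

/-- Bounds the logarithm in `pullBound` below by `log 2`, so that additive constants can be absorbed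
into it. -/
lemma log_two_add_log_le {δ : ℝ} (h0 : 0 < δ) (h1 : δ < 1) (hK : 2 ≤ K) {p : ℝ} (hp : 0 ≤ p) :
    Real.log 2 + Real.log (1 + p) ≤ Real.log (K * (1 + p) / δ) := by
  have hK' : (2 : ℝ) ≤ K := by exact_mod_cast hK
  rw [← Real.log_mul (by norm_num) (by positivity)]
  refine Real.log_le_log (by positivity) ?_
  rw [le_div_iff₀ h0]
  nlinarith [mul_le_mul_of_nonneg_right hK' (by positivity : 0 ≤ 1 + p)]

/-- An arm can only stay active as long as its number of counted pulls is below this bound. -/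
noncomputable def pullBound (K : ℕ) (δ Δ : ℝ) : ℝ :=
  (1 + Real.posLog (1 / Δ)) / Δ ^ 2 * Real.log (K * (1 + Real.posLog (1 / Δ)) / δ)

lemma pullBound_nonneg {δ : ℝ} (h0 : 0 < δ) (h1 : δ < 1) (hK : 2 ≤ K) (Δ : ℝ) :
    0 ≤ pullBound K δ Δ := by
  have hp : 0 ≤ Real.posLog (1 / Δ) := Real.posLog_nonneg
  have := log_two_add_log_le h0 h1 hK hp
  have := Real.log_nonneg (by linarith : 1 ≤ 1 + Real.posLog (1 / Δ))
  have := Real.log_nonneg (by norm_num : (1 : ℝ) ≤ 2)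
  exact mul_nonneg (by positivity) (by linarith)

/-- Squaring gives `Δ² T ≤ 32 log (8 K T² / δ)`, where `T` occurs on both sides. The tangent bound
on `log T` returns half of `Δ² T`, which is moved to the left. -/
lemma le_pullBound_of_le_radius {δ Δ : ℝ} (h0 : 0 < δ) (h1 : δ < 1) (hK : 2 ≤ K) (hΔ : 0 < Δ)
    {T : ℕ} (hT : 0 < T) (h : Δ ≤ 4 * radius K δ T) : (T : ℝ) ≤ 1152 * pullBound K δ Δ := by
  have hT' : (0 : ℝ) < T := by exact_mod_cast hT
  have hK' : (2 : ℝ) ≤ K := by exact_mod_cast hK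
  have hsq : Δ ^ 2 ≤ 16 * radius K δ T ^ 2 := by
    calc Δ ^ 2 ≤ (4 * radius K δ T) ^ 2 := pow_le_pow_left₀ hΔ.le h 2
      _ = _ := by ring
  rw [radius_sq h0 h1 (by omega) hT, ← mul_div_assoc, le_div_iff₀ hT'] at hsq
  have hlog : Real.log (8 * K * (T : ℝ) ^ 2 / δ) =
      3 * Real.log 2 + Real.log (K / δ) + 2 * Real.log T := by
    rw [show 8 * K * (T : ℝ) ^ 2 / δ = 2 ^ 3 * (K / δ) * (T : ℝ) ^ 2 by ring,
      Real.log_mul (by positivity) (by positivity), Real.log_mul (by positivity) (by positivity),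
      Real.log_pow, Real.log_pow]
    norm_num
  -- This is `log x ≤ x - 1` at `x = Δ² T / 128`; as `log T` enters with factor `64`, exactly `Δ² T
  -- / 2` arises.
  have hlogT : Real.log T ≤ Δ ^ 2 * T / 128 + 7 * Real.log 2 + 2 * Real.log (1 / Δ) := by
    have e : Real.log T = Real.log (Δ ^ 2 * T / 128) + 7 * Real.log 2 + 2 * Real.log (1 / Δ) := by
      rw [Real.log_div (by positivity) (by norm_num), Real.log_mul (by positivity) (by positivity),
        show (128 : ℝ) = 2 ^ 7 by norm_num, Real.log_pow, Real.log_pow, one_div, Real.log_inv]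
      push_cast
      ring
    have := Real.log_le_sub_one_of_pos (by positivity : 0 < Δ ^ 2 * T / 128)
    linarith
  have hp : 0 ≤ Real.posLog (1 / Δ) := Real.posLog_nonneg
  have hp' : Real.log (1 / Δ) ≤ Real.posLog (1 / Δ) := le_max_right _ _
  rw [pullBound, div_mul_eq_mul_div, ← mul_div_assoc, le_div_iff₀ (by positivity)]
  set p := Real.posLog (1 / Δ)
  have hL1 := log_two_add_log_le h0 h1 hK hp
  have hl := Real.log_nonneg (by linarith : 1 ≤ 1 + p)
  have hL2 : Real.log (K / δ) ≤ Real.log (K * (1 + p) / δ) := by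
    refine Real.log_le_log (by positivity) ?_
    gcongr
    nlinarith
  set L := Real.log (K * (1 + p) / δ)
  have h2 := Real.log_two_gt_d9
  have : p * (1 / 2) ≤ p * L := mul_le_mul_of_nonneg_left (by linarith) hp
  rw [hlog] at hsq
  -- With `p ≤ 2 p L` and `log 2 ≤ L`: `Δ² T ≤ 64 (17 log 2 + L + 4 p) ≤ 64 (18 + 8 p) L ≤ 1152 (1 +
  -- p) L`.
  nlinarith

lemma Concentrated.best_mem {δ : ℝ} {μ : Fin K → ℝ} {y : ℕ → Fin K → ℝ}
    (h : Concentrated δ μ y) {astar : Fin K} (hbest : ∀ a, a ≠ astar → μ a < μ astar) (r : ℕ) :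
    astar ∈ stackActive δ y r := by
  induction r with
  | zero => simp [stackActive]
  | succ r ih =>
    rw [stackActive]
    split_ifs
    · refine Finset.mem_filter.2 ⟨ih, fun b _ => ?_⟩
      have hb : μ b ≤ μ astar := by
        by_cases e : b = astar
        · rw [e]
        · exact (hbest b e).le
      have h1 := abs_le.1 (h r b)
      have h2 := abs_le.1 (h r astar)
      linarith
    · exact ih

/-- Two radii come from the elimination rule against the best arm, and one from each of the two
confidence intervals. -/
lemma Concentrated.gap_le {δ : ℝ} {μ : Fin K → ℝ} {y : ℕ → Fin K → ℝ}
    (h : Concentrated δ μ y) {astar : Fin K} (hbest : ∀ a, a ≠ astar → μ a < μ astar) {r : ℕ}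
    (hr : 1 < (stackActive δ y r).card) {a : Fin K} (ha : a ∈ stackActive δ y (r + 1)) :
    μ astar - μ a ≤ 4 * radius K δ (countedPulls r) := by
  rw [stackActive, if_pos hr] at ha
  have h0 := (Finset.mem_filter.1 ha).2 astar (h.best_mem hbest r)
  have h1 := abs_le.1 (h r a)
  have h2 := abs_le.1 (h r astar)
  linarith

lemma two_le_of_ne {a b : Fin K} (h : a ≠ b) : 2 ≤ K := by
  have := a.2
  have := b.2
  have := Fin.val_ne_of_ne h
  omega

lemma Concentrated.countedPulls_le {δ : ℝ} (h0 : 0 < δ) (h1 : δ < 1) {μ : Fin K → ℝ}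
    {y : ℕ → Fin K → ℝ} (h : Concentrated δ μ y) {astar : Fin K}
    (hbest : ∀ a, a ≠ astar → μ a < μ astar) {r : ℕ} (hr : 1 < (stackActive δ y r).card)
    {a : Fin K} (hne : a ≠ astar) (ha : a ∈ stackActive δ y (r + 1)) :
    (countedPulls r : ℝ) ≤ 1152 * pullBound K δ (μ astar - μ a) :=
  le_pullBound_of_le_radius h0 h1 (two_le_of_ne hne) (sub_pos.2 (hbest a hne))
    (countedPulls_pos r) (h.gap_le hbest hr ha)

/-- A sequence of active sets stops after exactly `R` phases. -/
def StopsAt (s : ℕ → Finset (Fin K)) (R : ℕ) : Prop :=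
  (∀ r < R, 1 < (s r).card) ∧ ¬ 1 < (s R).card

theorem Concentrated.exists_stopsAt {δ : ℝ} (h0 : 0 < δ) (h1 : δ < 1) {μ : Fin K → ℝ}
    {y : ℕ → Fin K → ℝ} (h : Concentrated δ μ y) {astar : Fin K}
    (hbest : ∀ a, a ≠ astar → μ a < μ astar) :
    ∃ R, StopsAt (stackActive δ y) R ∧ stackActive δ y R = {astar} := by
  have hex : ∃ R, ¬ 1 < (stackActive δ y R).card := by
    -- Otherwise a suboptimal arm survives every phase, although `countedPulls r` outgrows all the
    -- bounds.
    by_contra! hrun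
    obtain ⟨r, hr⟩ := exists_nat_gt (∑ a, 1152 * |pullBound K δ (μ astar - μ a)|)
    obtain ⟨a, ha, hne⟩ := Finset.exists_mem_ne (hrun (r + 1)) astar
    have b1 := h.countedPulls_le h0 h1 hbest (hrun r) hne ha
    have b2 : 1152 * |pullBound K δ (μ astar - μ a)| ≤
        ∑ a, 1152 * |pullBound K δ (μ astar - μ a)| :=
      Finset.single_le_sum (f := fun a => 1152 * |pullBound K δ (μ astar - μ a)|)
        (fun _ _ => by positivity) (Finset.mem_univ a)
    have b3 := le_abs_self (pullBound K δ (μ astar - μ a))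
    have b4 : (r : ℝ) ≤ countedPulls r := by
      exact_mod_cast Nat.lt_two_pow_self.le.trans (two_pow_le_countedPulls r)
    linarith
  classical
  refine ⟨Nat.find hex, ⟨fun r hr => not_not.1 (Nat.find_min hex hr), Nat.find_spec hex⟩, ?_⟩
  refine Finset.eq_singleton_iff_unique_mem.2 ⟨h.best_mem hbest _, fun a ha => ?_⟩
  exact Finset.card_le_one.1 (not_lt.1 (Nat.find_spec hex)) _ ha _ (h.best_mem hbest _)

lemma Concentrated.sum_pulls_le {δ : ℝ} (h0 : 0 < δ) (h1 : δ < 1) {μ : Fin K → ℝ}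
    {y : ℕ → Fin K → ℝ} (h : Concentrated δ μ y) {astar : Fin K}
    (hbest : ∀ a, a ≠ astar → μ a < μ astar) {a : Fin K} (hne : a ≠ astar) {R : ℕ}
    (hR : ∀ r < R, 1 < (stackActive δ y r).card) :
    ∑ r ∈ Finset.range R, (if a ∈ stackActive δ y r then (2 : ℝ) ^ r else 0) ≤
      1 + 2304 * pullBound K δ (μ astar - μ a) := by
  have hB := pullBound_nonneg h0 h1 (two_le_of_ne hne) (μ astar - μ a)
  induction R with
  | zero => simp only [Finset.range_zero, Finset.sum_empty]; positivity
  | succ R ih =>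
    by_cases ha : a ∈ stackActive δ y R
    · have hle : ∑ r ∈ Finset.range (R + 1), (if a ∈ stackActive δ y r then (2 : ℝ) ^ r else 0) ≤
          ∑ r ∈ Finset.range (R + 1), (2 : ℝ) ^ r :=
        Finset.sum_le_sum fun r _ => by split_ifs <;> [exact le_rfl; positivity]
      refine hle.trans ?_
      rw [geom_sum_eq (by norm_num)]
      rcases R with _ | q
      · norm_num; exact hB
      -- Being active in phase `q + 1` means surviving phase `q`; the whole sum is `2 ^ (q + 2) - 1
      -- = 1 + 2 (2 ^ (q + 1) - 1)`, which doubles `1152`. The first phase accounts for the `1`.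
      · have b := h.countedPulls_le h0 h1 hbest (hR q (by omega)) hne ha
        have e : (countedPulls q : ℝ) = 2 ^ (q + 1) - 1 := by
          rw [countedPulls, Nat.cast_sub Nat.one_le_two_pow]
          norm_num
        rw [e] at b
        rw [pow_succ]
        linarith
    · rw [Finset.sum_range_succ, if_neg ha, add_zero]
      exact ih fun r hr => hR r (by omega)

theorem Concentrated.total_pulls_le {δ : ℝ} (h0 : 0 < δ) (h1 : δ < 1) {μ : Fin K → ℝ}
    {y : ℕ → Fin K → ℝ} (h : Concentrated δ μ y) {astar : Fin K}
    (hbest : ∀ a, a ≠ astar → μ a < μ astar) {R : ℕ}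
    (hR : ∀ r < R, 1 < (stackActive δ y r).card) :
    ((∑ r ∈ Finset.range R, (stackActive δ y r).card * 2 ^ r : ℕ) : ℝ) ≤
      5000 * ∑ a ∈ Finset.univ.erase astar, (1 + pullBound K δ (μ astar - μ a)) := by
  -- The pulls of the best arm are charged to the others: at least two arms are active, so `card ≤ 2
  -- (card - 1)`.
  have hcard (r : ℕ) (hr : r < R) : ((stackActive δ y r).card : ℝ) ≤
      2 * ∑ a ∈ Finset.univ.erase astar, if a ∈ stackActive δ y r then (1 : ℝ) else 0 := by
    have e : (Finset.univ.erase astar).filter (· ∈ stackActive δ y r) =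
        (stackActive δ y r).erase astar := by
      ext a; simp [Finset.mem_erase]
    rw [Finset.sum_boole, e, Finset.card_erase_of_mem (h.best_mem hbest r)]
    have := hR r hr
    exact_mod_cast (by omega : (stackActive δ y r).card ≤ 2 * ((stackActive δ y r).card - 1))
  push_cast
  calc ∑ r ∈ Finset.range R, ((stackActive δ y r).card : ℝ) * 2 ^ r
      ≤ ∑ r ∈ Finset.range R, (2 * ∑ a ∈ Finset.univ.erase astar,
          if a ∈ stackActive δ y r then (1 : ℝ) else 0) * 2 ^ r :=
        Finset.sum_le_sum fun r hr =>
          mul_le_mul_of_nonneg_right (hcard r (Finset.mem_range.1 hr)) (by positivity)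
    _ = 2 * ∑ a ∈ Finset.univ.erase astar, ∑ r ∈ Finset.range R,
          if a ∈ stackActive δ y r then (2 : ℝ) ^ r else 0 := by
        rw [Finset.sum_comm, Finset.mul_sum]
        refine Finset.sum_congr rfl fun r _ => ?_
        rw [mul_assoc, Finset.sum_mul]
        simp only [ite_mul, one_mul, zero_mul]
    _ ≤ 2 * ∑ a ∈ Finset.univ.erase astar, (1 + 2304 * pullBound K δ (μ astar - μ a)) := by
        gcongr with a ha
        exact h.sum_pulls_le h0 h1 hbest (Finset.ne_of_mem_erase ha) hR
    _ ≤ 5000 * ∑ a ∈ Finset.univ.erase astar, (1 + pullBound K δ (μ astar - μ a)) := by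
        rw [Finset.mul_sum, Finset.mul_sum]
        refine Finset.sum_le_sum fun a ha => ?_
        have := pullBound_nonneg h0 h1 (two_le_of_ne (Finset.ne_of_mem_erase ha)) (μ astar - μ a)
        linarith

/-! ### The law of the whole system -/

lemma measurePreserving_rewards (W : Fin K → PMF (Fin K)) (ν : Fin K → Measure ℝ)
    [∀ a, IsProbabilityMeasure (ν a)] :
    MeasurePreserving (fun (ω : ℕ → (Fin K → Fin K) × (Fin K → ℝ)) t => (ω t).2)
      (systemLaw W ν) (rewardLaw ν) := by
  refine ⟨by fun_prop, ?_⟩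
  rw [systemLaw, Measure.infinitePi_map_pi _ (f := fun _ => Prod.snd) fun _ => measurable_snd,
    rewardLaw]
  simp_rw [measurePreserving_snd.map_eq]

lemma ae_mem_support (W : Fin K → PMF (Fin K)) (ν : Fin K → Measure ℝ)
    [∀ a, IsProbabilityMeasure (ν a)] :
    ∀ᵐ ω ∂(systemLaw W ν), ∀ t v, (ω t).1 v ∈ (W v).support := by
  refine ae_all_iff.2 fun t => ae_all_iff.2 fun v => ?_
  have h : MeasurePreserving (fun ω : ℕ → (Fin K → Fin K) × (Fin K → ℝ) => (ω t).1 v)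
      (systemLaw W ν) (W v).toMeasure :=
    (measurePreserving_eval (fun v => (W v).toMeasure) v).comp
      (measurePreserving_fst.comp (measurePreserving_eval_infinitePi
        (fun _ : ℕ => (Measure.pi fun v => (W v).toMeasure).prod (Measure.pi ν)) t))
  refine h.quasiMeasurePreserving.ae (p := fun z => z ∈ (W v).support) ?_
  rw [ae_iff, PMF.toMeasure_apply_eq_zero_iff _ (Set.toFinite _).measurableSet]
  exact Set.disjoint_left.2 fun z hz hz' => hz' hz

/-! ### Transfer between the models -/

/-- The sequence of active sets stops after exactly `R` phases, with at most `N` counted pulls. -/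
def StopsWithin (N : ℕ∞) (R : ℕ) (s : ℕ → Finset (Fin K)) : Prop :=
  StopsAt s R ∧ ((∑ r ∈ Finset.range R, (s r).card * 2 ^ r : ℕ) : ℕ∞) ≤ N

lemma StopsAt.congr {s s' : ℕ → Finset (Fin K)} {R : ℕ} (h : ∀ j ≤ R, s j = s' j)
    (hs : StopsAt s R) : StopsAt s' R :=
  ⟨fun r hr => h r hr.le ▸ hs.1 r hr, h R le_rfl ▸ hs.2⟩

lemma StopsWithin.congr {N : ℕ∞} (R : ℕ) (s s' : ℕ → Finset (Fin K)) (h : ∀ j ≤ R, s j = s' j)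
    (hs : StopsWithin N R s) : StopsWithin N R s' := by
  refine ⟨hs.1.congr h, le_of_eq_of_le ?_ hs.2⟩
  rw [Finset.sum_congr rfl fun r hr => by rw [← h r (Finset.mem_range.1 hr).le]]

lemma IsDelayedRun.stopsAfter_iff {δ : ℝ} {n : ℕ → ℕ} {x : ℕ → Fin K → ℝ}
    {run : ℕ → RunState K} (h : IsDelayedRun δ n x run) (R : ℕ) :
    StopsAfter run R ↔ StopsAt (delayedActive δ n x) R := by
  simp only [StopsAfter, StopsAt, h.active_eq]

lemma IsDelayedRun.length_pulled_of_stopsAt {δ : ℝ} {n : ℕ → ℕ} {x : ℕ → Fin K → ℝ}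
    {run : ℕ → RunState K} (h : IsDelayedRun δ n x run) {R : ℕ}
    (hR : StopsAt (delayedActive δ n x) R) : (run R).pulled.length =
      ∑ r ∈ Finset.range R, (delayedActive δ n x r).card * 2 ^ r + ∑ r ∈ Finset.range R, n r := by
  rw [h.length_pulled R ((h.stopsAfter_iff R).2 hR).1]
  simp only [h.active_eq]

lemma measureReal_clean_stopsWithin (δ : ℝ) (ν : Fin K → Measure ℝ)
    [∀ a, IsProbabilityMeasure (ν a)] (N : ℕ∞) :
    (rewardLaw ν).real {x | ∃ R, StopsAfter (cleanRun δ x) R ∧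
      ((cleanRun δ x R).pulled.length : ℕ∞) ≤ N} =
    (rewardLaw ν).real {y | ∃ R, StopsWithin N R (stackActive δ y)} := by
  have h := (measure_delayed (δ := δ) (n := fun _ => 0) (E := StopsWithin N)
    StopsWithin.congr ν).2
  rw [measureReal_def, measureReal_def, ← h]
  congr 3
  ext x
  refine exists_congr fun R => ?_
  have hx := isDelayedRun_clean δ x
  rw [hx.stopsAfter_iff, StopsWithin]
  refine and_congr_right fun hR => ?_
  rw [hx.length_pulled_of_stopsAt hR, Finset.sum_const_zero, add_zero]

/-- An inequality suffices, as only the event on the delayed history has to be measurable; `A`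
contains it up to a null set. -/
lemma measureReal_le_packet {W : Fin K → PMF (Fin K)} {δ : ℝ} {ν : Fin K → Measure ℝ}
    [∀ a, IsProbabilityMeasure (ν a)] {P : ℕ → Finset (Finset (Fin K))} {n : ℕ → ℕ}
    (code : ∀ r, ZeroErrorPacket W (P r) (n r)) (h₀ : Fin K)
    (hP : ∀ᵐ ω ∂(systemLaw W ν), ∀ r, 1 < (packetRun δ code h₀ ω r).active.card →
      (packetRun δ code h₀ ω r).active ∈ P r)
    {E : ℕ → (ℕ → Finset (Fin K)) → Prop}
    (hE : ∀ R s s', (∀ j ≤ R, s j = s' j) → E R s → E R s')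
    {A : Set (ℕ → (Fin K → Fin K) × (Fin K → ℝ))}
    (hA : ∀ ω, IsDelayedRun δ n (fun t => (ω t).2) (packetRun δ code h₀ ω) →
      (∃ R, E R (delayedActive δ n fun t => (ω t).2)) → ω ∈ A) :
    (rewardLaw ν).real {y | ∃ R, E R (stackActive δ y)} ≤ (systemLaw W ν).real A := by
  have : IsProbabilityMeasure (systemLaw W ν) := by unfold systemLaw; infer_instance
  obtain ⟨hm, heq⟩ := measure_delayed (δ := δ) (n := n) hE ν
  rw [measureReal_def, measureReal_def, ← heq,
    ← (measurePreserving_rewards W ν).measure_preimage hm.nullMeasurableSet]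
  refine ENNReal.toReal_mono (measure_ne_top _ _) (measure_mono_ae ?_)
  filter_upwards [hP, ae_mem_support W ν] with ω h1 h2 h3
  exact hA ω (isDelayedRun_packet δ code h₀ ω h2 h1) h3

/-! ### The clean complexity -/

theorem cleanComplexity_le {δ : ℝ} (h0 : 0 < δ) (h1 : δ < 1) {μ : Fin K → ℝ} {astar : Fin K}
    (hbest : ∀ a, a ≠ astar → μ a < μ astar) :
    cleanComplexity δ μ ≤
      (⌊5000 * ∑ a ∈ Finset.univ.erase astar, (1 + pullBound K δ (μ astar - μ a))⌋₊ : ℕ∞) := by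
  refine sInf_le fun ν hprob hν => ?_
  rw [measureReal_clean_stopsWithin]
  refine (measureReal_concentrated h0 h1 hν).trans (measureReal_mono fun y hy => ?_)
  obtain ⟨R, hR, -⟩ := Concentrated.exists_stopsAt h0 h1 hy hbest
  exact ⟨R, hR, Nat.cast_le.2 (Nat.le_floor (hy.total_pulls_le h0 h1 hbest hR.1))⟩

/-- The infimum is attained: finiteness makes the set nonempty, and `ℕ∞` is well-ordered. -/
lemma le_measureReal_stopsWithin_cleanComplexity (δ : ℝ) {ν : Fin K → Measure ℝ}
    {μ : Fin K → ℝ} [hprob : ∀ a, IsProbabilityMeasure (ν a)] (hν : IsSubGaussianInstance ν μ)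
    (hfin : cleanComplexity δ μ ≠ ⊤) :
    1 - δ ≤ (rewardLaw ν).real
      {y | ∃ R, StopsWithin (cleanComplexity δ μ) R (stackActive δ y)} := by
  rw [← measureReal_clean_stopsWithin]
  set I : Set ℕ∞ := {N : ℕ∞ | ∀ ν : Fin K → Measure ℝ, (∀ a, IsProbabilityMeasure (ν a)) →
    IsSubGaussianInstance ν μ →
    1 - δ ≤ (rewardLaw ν).real {x | ∃ R, StopsAfter (cleanRun δ x) R ∧
      ((cleanRun δ x R).pulled.length : ℕ∞) ≤ N}} with hI
  have hne : I.Nonempty := by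
    by_contra hne
    rw [Set.not_nonempty_iff_eq_empty] at hne
    exact hfin (by rw [cleanComplexity, ← hI, hne, sInf_empty])
  have hmem : cleanComplexity δ μ ∈ I := csInf_mem hne
  exact hmem ν hprob hν

end PSE

theorem mainTheorem1 :
    ∃ C : ℝ, 0 < C ∧
      ∀ (K : ℕ) (W : Fin K → PMF (Fin K)) (δ : ℝ), 0 < δ → δ < 1 →
      ∀ (ν : Fin K → Measure ℝ) (μ : Fin K → ℝ), (∀ a, IsProbabilityMeasure (ν a)) →
      PSE.IsSubGaussianInstance ν μ →
      ∀ astar : Fin K, (∀ a, a ≠ astar → μ a < μ astar) →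
      ∀ (P : ℕ → Finset (Finset (Fin K))) (n : ℕ → ℕ),
      (∀ r, (P r).card ≤ (PSE.strongPower (PSE.confusabilityGraph W) (n r)).indepNum) →
      -- zero-error plan packets of the lengths `n r` exist
      (∀ r, Nonempty (PSE.ZeroErrorPacket W (P r) (n r))) ∧
      -- the clean complexity
      (PSE.cleanComplexity δ μ : ℝ≥0∞) ≤ ENNReal.ofReal (C * ∑ a ∈ Finset.univ.erase astar,
        (1 + (1 + Real.posLog (1 / (μ astar - μ a))) / (μ astar - μ a) ^ 2 *
          Real.log (K * (1 + Real.posLog (1 / (μ astar - μ a))) / δ))) ∧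
      ∀ (code : ∀ r, PSE.ZeroErrorPacket W (P r) (n r)) (h₀ : Fin K),
        -- almost surely, every plan that has to be sent belongs to the plan family of its phase
        (∀ᵐ ω ∂(PSE.systemLaw W ν), ∀ r, 1 < (PSE.packetRun δ code h₀ ω r).active.card →
          (PSE.packetRun δ code h₀ ω r).active ∈ P r) →
        -- correctness
        1 - δ ≤ (PSE.systemLaw W ν).real {ω | PSE.Returns (PSE.packetRun δ code h₀ ω) astar} ∧
        -- number of physical rounds
        1 - δ ≤ (PSE.systemLaw W ν).real {ω | ∃ R,
          PSE.StopsAfter (PSE.packetRun δ code h₀ ω) R ∧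
          ((PSE.packetRun δ code h₀ ω R).pulled.length : ℕ∞) ≤
            PSE.cleanComplexity δ μ + ((∑ r ∈ Finset.range R, n r : ℕ) : ℕ∞)} := by
  refine ⟨5000, by norm_num, fun K W δ h0 h1 ν μ hprob hν astar hbest P n hPn =>
    ⟨fun r => PSE.nonempty_zeroErrorPacket astar.pos (hPn r), ?_, fun code h₀ hP => ⟨?_, ?_⟩⟩⟩
  · refine (ENat.toENNReal_le.2 (PSE.cleanComplexity_le h0 h1 hbest)).trans ?_
    rw [ENat.toENNReal_coe, ← ENNReal.ofReal_natCast]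
    refine ENNReal.ofReal_le_ofReal (Nat.floor_le (mul_nonneg (by norm_num)
      (Finset.sum_nonneg fun a ha => ?_)))
    have := PSE.pullBound_nonneg h0 h1 (PSE.two_le_of_ne (Finset.ne_of_mem_erase ha))
      (μ astar - μ a)
    linarith
  · refine (PSE.measureReal_concentrated h0 h1 hν).trans ((measureReal_mono fun y hy =>
      PSE.Concentrated.exists_stopsAt h0 h1 hy hbest).trans
      -- Stopping with the best arm is decided by the history up to the stopping phase, so it
      -- transfers from the stack model.
      (PSE.measureReal_le_packet (E := fun R s => PSE.StopsAt s R ∧ s R = {astar}) code h₀ hP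
        (fun R s s' h hs => ⟨hs.1.congr h, (h R le_rfl).symm.trans hs.2⟩) fun ω hω => ?_))
    rintro ⟨R, hR, hstar⟩
    exact ⟨R, (hω.stopsAfter_iff R).2 hR, (hω.active_eq R).trans hstar⟩
  · have hfin : PSE.cleanComplexity δ μ ≠ ⊤ :=
      ((PSE.cleanComplexity_le h0 h1 hbest).trans_lt (ENat.natCast_lt_top _)).ne
    refine (PSE.le_measureReal_stopsWithin_cleanComplexity δ hν hfin).trans
      (PSE.measureReal_le_packet code h₀ hP PSE.StopsWithin.congr fun ω hω => ?_)
    rintro ⟨R, hR, hN⟩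
    refine ⟨R, (hω.stopsAfter_iff R).2 hR, ?_⟩
    rw [hω.length_pulled_of_stopsAt hR, Nat.cast_add]
    exact add_le_add_left hN _
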